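/- Let $k\ge 2$ be an integer and let $\mathbf{x}=(x(n))_{n\ge 0}$ and $\mathbf{y}=(y(n))_{n\ge 0}$ be $k$-automatic sequences, i.e. for each of them there is a finite deterministic automaton with output which, on reading the base-$k$ representation of $n$, ends in a state whose output is the $n$-th term. Let $\mathbb{N}_\infty=\mathbb{N}\cup\{\infty\}$ be the semiring of extended non-negative integers, with $a+\infty=\infty$, $a\cdot\infty=\infty$ for $a\neq 0$ and $0\cdot\infty=0$. A sequence $f:\mathbb{N}\to\mathbb{N}_\infty$ is $(\mathbb{N}_\infty,k)$-regular if there are $r\geq 0$, a row vector $u$, a column vector $v$ and a morphism $\mu$ from $\{0,\dots,k-1\}^*$ to the $r\times r$ matrices, all with entries in $\mathbb{N}_\infty$, such that $f([w]_k)=u\,\mu(w)\,v$ for every word $w\in\{0,\dots,k-1\}^*$, where $[w]_k$ is the integer that $w$ represents in base $k$ (most significant digit first, leading zeros allowed). Conventions. The factor $\mathbf{x}[i..i+l-1]=x(i)\cdots x(i+l-1)$ with $l\ge 1$ begins at position $i$ and ends at position $i+l-1$. It is centred at position $n$ if $n$ is its middle position; as a factor of even length has two middle positions, "centred at $n$"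 may be read in any one of the following ways (the same one for all $n$), and the assertions below hold for each of them: $n=i+\lfloor (l-1)/2\rfloor$; or $n=i+\lfloor l/2\rfloor$; or $l$ is odd and $n=i+(l-1)/2$. A square is a word $uu$ with $u$ nonempty; a palindrome is a nonempty word equal to its reversal; a fractional power with exponent $|w|/|u|$ is a word $w=u^mu'$ with $u$ nonempty, $m\ge 1$ an integer and $u'$ a prefix of $u$ (a word may have several exponents). The length of the longest word of a given kind is $\infty$ if the lengths are unbounded, and $0$ if there is no such word. A factor of $\mathbf{x}$ is recurrent if it occurs infinitely often in $\mathbf{x}$. Then the following sequences (indexed by $n\ge 0$) are $(\mathbb{N}_\infty,k)$-regular: (a) the number of distinct square factors of $\mathbf{x}$ of length $n$; (b) the number of squares in $\mathbf{x}$ beginning at (centred at, ending at) position $n$; (c) the length of the longest square in $\mathbf{x}$ beginning at (centred at, ending at) position $n$; (d) the number of palindromes in $\mathbf{x}$ beginning at (centred at, ending at) position $n$; (e) the length of the longest palindrome in $\mathbf{x}$ beginning at (centred at, ending at) position $n$; (f) the length of the longest fractional power in $\mathbf{x}$ beginning at (ending at) position $n$; and likewise, for every rational number $r$, the length of the longest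 factor of $\mathbf{x}$ beginning at (ending at) position $n$ that is a fractional power with an exponent $\ge r$, respectively with an exponent $>r$; (g) the number of distinct recurrent factors of $\mathbf{x}$ of length $n$; (h) the number of distinct factors of length $n$ that occur in $\mathbf{x}$ but not in $\mathbf{y}$; (i) the number of distinct factors of length $n$ that occur in both $\mathbf{x}$ and $\mathbf{y}$. -/

import Mathlib

namespace AutoSeq

/-! ### Base-`k` words -/

/-- `[w]_k`, the integer represented in base `k` by the word `w`, most significant digit first. -/
def wordValue {k : ℕ} (w : List (Fin k)) : ℕ :=
  w.foldl (fun v d => k * v + (d : ℕ)) 0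

/-- `C_k`: the words over `{0, …, k-1}` without leading zero (the empty word represents `0`).
For `k ≥ 2` the map `wordValue` is a bijection from these words to `ℕ`. -/
def IsCanonical {k : ℕ} (w : List (Fin k)) : Prop :=
  ∀ d ∈ w.head?, (d : ℕ) ≠ 0

/-! ### Automatic sequences -/

/-- A deterministic automaton with output: input letters in `{0, …, k-1}`, states in `σ`, and an
output in `α` attached to each state. -/
structure DFAO (k : ℕ) (α : Type*) (σ : Type) where
  step : σ → Fin k → σ
  start : σ
  output : σ → α

/-- The output attached to the last state encountered when reading `w`. -/
def DFAO.run {k : ℕ} {α : Type*} {σ : Type} (M : DFAO k α σ) (w : List (Fin k)) : α :=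
  M.output (w.foldl M.step M.start)

/-- `x` is `k`-automatic: some finite automaton, on reading the base-`k` representation of `n`,
outputs `x n`. -/
def IsAutomatic {α : Type*} (k : ℕ) (x : ℕ → α) : Prop :=
  ∃ (σ : Type) (_ : Finite σ) (M : DFAO k α σ),
    ∀ w : List (Fin k), IsCanonical w → x (wordValue w) = M.run w

/-! ### Recognizable series and regular sequences -/

/-- The formal series `h : Σ* → R` is `R`-recognizable: `h w = u μ(w) v` for a row vector `u`, a
column vector `v` and a morphism `μ` from words to square matrices (determined by its values on
letters), all with entries in `R`. -/
def IsRecognizable {A : Type*} (R : Type*) [Semiring R] (h : List A → R) : Prop :=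
  ∃ (r : ℕ) (u : Fin r → R) (μ : A → Matrix (Fin r) (Fin r) R) (v : Fin r → R),
    ∀ w : List A, h w = u ⬝ᵥ ((w.map μ).prod.mulVec v)

/-- `f` is `(R, k)`-regular: the series `w ↦ f([w]_k)` over `{0, …, k-1}` is `R`-recognizable. -/
def IsRegularSeq (R : Type*) [Semiring R] (k : ℕ) (f : ℕ → R) : Prop :=
  IsRecognizable R (fun w : List (Fin k) => f (wordValue w))

/-! ### Factors -/

/-- `x[i..i+l-1]`, the factor of length `l` of `x` beginning at position `i`. -/
def factor {α : Type*} (x : ℕ → α) (i l : ℕ) : List α :=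
  (List.range l).map (fun t => x (i + t))

/-- The word `w` occurs in `x` at position `i`. -/
def OccursAt {α : Type*} (x : ℕ → α) (w : List α) (i : ℕ) : Prop :=
  factor x i w.length = w

/-- `w` is a factor of `x`. -/
def IsFactor {α : Type*} (x : ℕ → α) (w : List α) : Prop :=
  ∃ i, OccursAt x w i

/-- `w` is a recurrent factor of `x`: it occurs infinitely often. -/
def IsRecurrentFactor {α : Type*} (x : ℕ → α) (w : List α) : Prop :=
  {i | OccursAt x w i}.Infinite

/-- `w` is a (nonempty) square. -/
def IsSquareWord {α : Type*} (w : List α) : Prop :=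
  ∃ u : List α, u ≠ [] ∧ w = u ++ u

/-- `w` is a (nonempty) palindrome. -/
def IsPalindromeWord {α : Type*} (w : List α) : Prop :=
  w ≠ [] ∧ w.reverse = w

/-- `w` is a fractional power with exponent `e`: `w = uᵐ u'` with `u` nonempty, `m ≥ 1`,
`u'` a prefix of `u`, and `e = |w| / |u|`.  A word may have several exponents. -/
def HasExponent {α : Type*} (w : List α) (e : ℚ) : Prop :=
  ∃ (u u' : List α) (m : ℕ), u ≠ [] ∧ 1 ≤ m ∧ u' <+: u ∧
    w = (List.replicate m u).flatten ++ u' ∧ e = (w.length : ℚ) / (u.length : ℚ)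

/-- `w` is a fractional power (of some exponent). -/
def IsFractionalPower {α : Type*} (w : List α) : Prop :=
  ∃ e : ℚ, HasExponent w e

/-! ### Factors located at a position -/

/-- The ways in which an occurrence of a nonempty factor can be located at a position.  A factor of
even length has two middle letters, whence the two conventions `centreLeft` and `centreRight`
for its centre; `centreExact` admits only factors with one middle letter. -/
inductive Anchor where
  | start
  | centreLeft
  | centreRight
  | centreExact
  | finish

/-- The factor `x[i..i+l-1]`, where `l ≥ 1`, begins / is centred / ends at position `n`. -/
def Anchor.Locates : Anchor → (i l n : ℕ) → Prop
  | .start, i, _, n => n = i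
  | .centreLeft, i, l, n => n = i + (l - 1) / 2
  | .centreRight, i, l, n => n = i + l / 2
  | .centreExact, i, l, n => 2 * n + 1 = 2 * i + l
  | .finish, i, l, n => n + 1 = i + l

/-- The words with property `P` that occur in `x` at the position `n`, in the sense of `A`. -/
def wordsAt {α : Type*} (x : ℕ → α) (P : List α → Prop) (A : Anchor) (n : ℕ) : Set (List α) :=
  {w | P w ∧ ∃ i, OccursAt x w i ∧ A.Locates i w.length n}

/-- The length of a longest word in `S`: `∞` if the lengths are unbounded, `0` if `S = ∅`. -/
noncomputable def longest {α : Type*} (S : Set (List α)) : ℕ∞ :=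
  ⨆ w ∈ S, (w.length : ℕ∞)

end AutoSeq

open AutoSeq

namespace AutoSeq

/-! ### Digit spaces and recognizable functions -/

/-! Each sequence counts the `m` for which a relation `P n m` holds, where `P` is first-order over
the naturals with addition, order and the letters of `x` and `y`. Such relations are recognized by
finite automata reading the digits of all variables in parallel: automata are closed under Boolean
operations and projection (`Recog.exists'`), and they decide linear inequalities (`Recog.le`).

Counting then gives regularity (`Recog.isRegularSeq_encard`): the vector whose entry at a state `s`
is the number of `m` that bring `(n, m)` to `s` changes by a matrix when a digit is appended to `n`.

It remains to express each quantity as such a count. Words at a position are determined by their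
lengths; a supremum of lengths is the number of `m` below some length; distinct factors of length
`n` are counted by their first occurrences.

In `Recog` the state is a function of the numbers themselves, not of words representing them, so
leading zeros and the padding of tuples to equal length need no treatment. -/

/-- A space of tuples of natural numbers, to each of which a tuple of base-`k` digits can be
appended. -/
class DigitSpace (k : ℕ) (D : Type) where
  Dig : Type
  finite_dig : Finite Dig
  append : D → Dig → D

attribute [instance] DigitSpace.finite_dig

instance DigitSpace.nat (k : ℕ) : DigitSpace k ℕ where
  Dig := Fin k
  finite_dig := inferInstance
  append n d := k * n + d

instance DigitSpace.prod (k : ℕ) (D E : Type) [DigitSpace k D] [DigitSpace k E] :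
    DigitSpace k (D × E) where
  Dig := DigitSpace.Dig k D × DigitSpace.Dig k E
  finite_dig := inferInstance
  append p d := (DigitSpace.append p.1 d.1, DigitSpace.append p.2 d.2)

/-- `g` is computed by a finite automaton reading the base-`k` digits of its arguments in parallel,
most significant digits first. -/
def Recog (k : ℕ) {D : Type} [DigitSpace k D] {β : Type*} (g : D → β) : Prop :=
  ∃ (σ : Type) (_ : Finite σ) (q : D → σ) (step : σ → DigitSpace.Dig k D → σ) (out : σ → β),
    (∀ p d, q (DigitSpace.append p d) = step (q p) d) ∧ ∀ p, g p = out (q p)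

/-- `f` changes in an affine way when digits are appended to its argument. -/
def IsAffine (k : ℕ) {D : Type} [DigitSpace k D] (f : D → ℕ) : Prop :=
  ∃ δ : DigitSpace.Dig k D → ℤ, ∀ p d, (f (DigitSpace.append p d) : ℤ) = k * f p + δ d

section Closure

variable {k : ℕ} {D E : Type} [DigitSpace k D] [DigitSpace k E]

namespace IsAffine

theorem fst {f : D → ℕ} (hf : IsAffine k f) : IsAffine k (fun p : D × E => f p.1) := by
  obtain ⟨δ, h⟩ := hf
  exact ⟨fun d => δ d.1, fun p d => h p.1 d.1⟩

theorem snd {f : E → ℕ} (hf : IsAffine k f) : IsAffine k (fun p : D × E => f p.2) := by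
  obtain ⟨δ, h⟩ := hf
  exact ⟨fun d => δ d.2, fun p d => h p.2 d.2⟩

theorem id : IsAffine k (fun n : ℕ => n) :=
  ⟨fun d : Fin k => ((d : ℕ) : ℤ), fun n (d : Fin k) => Nat.cast_add (k * n) (d : ℕ) |>.trans (by rw [Nat.cast_mul])⟩

theorem var : IsAffine k (fun p : D × ℕ => p.2) := id.snd

theorem var_fst : IsAffine k (fun p : ℕ × E => p.1) := id.fst

theorem const (c : ℕ) : IsAffine k (fun _ : D => c) :=
  ⟨fun _ => c - k * c, fun p d => by ring⟩

theorem add {f g : D → ℕ} (hf : IsAffine k f) (hg : IsAffine k g) :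
    IsAffine k (fun p => f p + g p) := by
  obtain ⟨δ, h⟩ := hf
  obtain ⟨ε, h'⟩ := hg
  exact ⟨fun d => δ d + ε d, fun p d => by push_cast; rw [h, h']; ring⟩

theorem const_mul {f : D → ℕ} (c : ℕ) (hf : IsAffine k f) : IsAffine k (fun p => c * f p) := by
  obtain ⟨δ, h⟩ := hf
  exact ⟨fun d => c * δ d, fun p d => by push_cast; rw [h]; ring⟩

end IsAffine

namespace Recog

theorem map {β γ : Type*} {g : D → β} (hg : Recog k g) (φ : β → γ) :
    Recog k (fun p => φ (g p)) := by
  obtain ⟨σ, hσ, q, step, out, hq, ho⟩ := hg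
  exact ⟨σ, hσ, q, step, fun s => φ (out s), hq, fun p => congrArg φ (ho p)⟩

theorem map₂ {β γ δ : Type*} {g : D → β} {h : D → γ} (hg : Recog k g) (hh : Recog k h)
    (φ : β → γ → δ) : Recog k (fun p => φ (g p) (h p)) := by
  obtain ⟨σ, hσ, q, step, out, hq, ho⟩ := hg
  obtain ⟨τ, hτ, q', step', out', hq', ho'⟩ := hh
  exact ⟨σ × τ, inferInstance, fun p => (q p, q' p), fun s d => (step s.1 d, step' s.2 d),
    fun s => φ (out s.1) (out' s.2), fun p d => Prod.ext (hq p d) (hq' p d),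
    fun p => congrArg₂ φ (ho p) (ho' p)⟩

theorem fst {β : Type*} {g : D → β} (hg : Recog k g) : Recog k (fun p : D × E => g p.1) := by
  obtain ⟨σ, hσ, q, step, out, hq, ho⟩ := hg
  exact ⟨σ, hσ, fun p => q p.1, fun s d => step s d.1, out, fun p d => hq p.1 d.1,
    fun p => ho p.1⟩

theorem snd {β : Type*} {g : E → β} (hg : Recog k g) : Recog k (fun p : D × E => g p.2) := by
  obtain ⟨σ, hσ, q, step, out, hq, ho⟩ := hg
  exact ⟨σ, hσ, fun p => q p.2, fun s d => step s d.2, out, fun p d => hq p.2 d.2,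
    fun p => ho p.2⟩

theorem congr {P Q : D → Prop} (hP : Recog k P) (h : ∀ p, Q p ↔ P p) : Recog k Q := by
  rwa [show Q = P from funext fun p => propext (h p)]

theorem not {P : D → Prop} (hP : Recog k P) : Recog k (fun p => ¬ P p) := hP.map _

theorem and {P Q : D → Prop} (hP : Recog k P) (hQ : Recog k Q) : Recog k (fun p => P p ∧ Q p) :=
  hP.map₂ hQ _

theorem imp {P Q : D → Prop} (hP : Recog k P) (hQ : Recog k Q) : Recog k (fun p => P p → Q p) :=
  hP.map₂ hQ (fun a b => a → b)

variable [hk : Fact (2 ≤ k)]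

theorem exists_append (m : ℕ) : ∃ (m' : ℕ) (e : DigitSpace.Dig k ℕ),
    m = DigitSpace.append m' e :=
  ⟨m / k, (⟨m % k, Nat.mod_lt _ (by have := hk.out; omega)⟩ : Fin k), (Nat.div_add_mod m k).symm⟩

/-- Subset construction: the state at `p` is the set of states reached by `(p, m)` over all `m`.
Since every `m` is some `m'` with a digit appended, the next set depends only on the current one and
the digit read. Witnesses with more digits than `p` are already included in the set. -/
theorem exists' {P : D → ℕ → Prop} (hP : Recog k (fun p : D × ℕ => P p.1 p.2)) :
    Recog k (fun p => ∃ m, P p m) := by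
  obtain ⟨σ, hσ, q, step, out, hq, ho⟩ := hP
  refine ⟨Set σ, inferInstance, fun p => Set.range fun m => q (p, m),
    fun S d => {s | ∃ t ∈ S, ∃ e, s = step t (d, e)}, fun S => ∃ s ∈ S, out s, ?_, ?_⟩
  · intro p d
    ext s
    constructor
    · rintro ⟨m, rfl⟩
      obtain ⟨m', e, rfl⟩ := exists_append (k := k) m
      exact ⟨_, ⟨m', rfl⟩, e, hq (p, m') (d, e)⟩
    · rintro ⟨_, ⟨m', rfl⟩, e, rfl⟩
      exact ⟨DigitSpace.append m' e, hq (p, m') (d, e)⟩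
  · intro p
    simp [fun m => ho (p, m)]

theorem forall' {P : D → ℕ → Prop} (hP : Recog k (fun p : D × ℕ => P p.1 p.2)) :
    Recog k (fun p => ∀ m, P p m) :=
  (exists' (P := fun p m => ¬ P p m) hP.not).not.congr fun p => by simp

/-- The difference `z = f p - g p` evolves by `z ↦ k * z + η` with `η` bounded by some `C`. Once
`|z| ≥ C` it stays so with the same sign, because `k * C - C ≥ C`; hence `z` clamped to `[-C, C]` is
a sufficient finite state. -/
theorem le {f g : D → ℕ} (hf : IsAffine k f) (hg : IsAffine k g) :
    Recog k (fun p => f p ≤ g p) := by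
  obtain ⟨δ, h⟩ := hf
  obtain ⟨ε, h'⟩ := hg
  obtain ⟨B, hB⟩ := (Set.finite_range fun d => |δ d - ε d|).bddAbove
  have hB' : ∀ d, |δ d - ε d| ≤ max B 1 := fun d => (hB ⟨d, rfl⟩).trans (le_max_left _ _)
  -- A bound of at least `1` keeps positive differences distinguishable from `0` after clamping.
  have hC : (1 : ℤ) ≤ max B 1 := le_max_right _ _
  generalize max B 1 = C at hB' hC
  have hk2 : (2 : ℤ) ≤ k := by exact_mod_cast hk.out
  let clamp : ℤ → Set.Icc (-C) C := Set.projIcc (-C) C (by omega)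
  have hclamp : ∀ z, (clamp z : ℤ) = max (-C) (min C z) := fun z => rfl
  refine ⟨Set.Icc (-C) C, inferInstance, fun p => clamp (f p - g p),
    fun s d => clamp (k * (s : ℤ) + (δ d - ε d)), fun s => (s : ℤ) ≤ 0, ?_, ?_⟩
  · intro p d
    apply Subtype.ext
    have hd := abs_le.1 (hB' d)
    dsimp only
    rw [h, h']
    generalize (f p : ℤ) = a
    generalize (g p : ℤ) = b
    have e : (k : ℤ) * a + δ d - (k * b + ε d) = k * (a - b) + (δ d - ε d) := by ring
    simp only [hclamp]
    rw [e]
    generalize a - b = z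
    generalize δ d - ε d = η at hd
    rcases le_total z (-C) with hz | hz
    · rw [min_eq_right (by omega : z ≤ C), max_eq_left hz]
      have h1 : (k : ℤ) * z ≤ k * (-C) := by gcongr
      have h2 : (k : ℤ) * (-C) ≤ 2 * (-C) := by nlinarith
      omega
    rcases le_total C z with hz' | hz'
    · rw [min_eq_left hz', max_eq_right (by omega : -C ≤ C)]
      have h1 : (k : ℤ) * C ≤ k * z := by gcongr
      have h2 : 2 * C ≤ (k : ℤ) * C := by nlinarith
      omega
    · rw [min_eq_right hz', max_eq_right hz]
  · intro p
    simp only [hclamp, eq_iff_iff]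
    omega

theorem lt {f g : D → ℕ} (hf : IsAffine k f) (hg : IsAffine k g) :
    Recog k (fun p => f p < g p) :=
  (le hg hf).not.congr fun p => by simp

theorem eq {f g : D → ℕ} (hf : IsAffine k f) (hg : IsAffine k g) :
    Recog k (fun p => f p = g p) :=
  ((le hf hg).and (le hg hf)).congr fun p => by omega

/-- An affine term need not change by appending a digit, since its increment may lie outside `[0,
k)`. So the values are quantified as new variables and tied to the terms by equations. -/
theorem comp₂ {R : ℕ → ℕ → Prop} (hR : Recog k (fun p : ℕ × ℕ => R p.1 p.2)) {f g : D → ℕ}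
    (hf : IsAffine k f) (hg : IsAffine k g) : Recog k (fun p => R (f p) (g p)) := by
  have h : Recog k (fun p : D => ∃ a b, R a b ∧ a = f p ∧ b = g p) := by
    refine exists' (exists' (.and ?_ (.and (eq IsAffine.var.fst hf.fst.fst)
      (eq .var hg.fst.fst))))
    obtain ⟨σ, hσ, q, step, out, hq, ho⟩ := hR
    exact ⟨σ, hσ, fun p => q (p.1.2, p.2), fun s d => step s (d.1.2, d.2), out,
      fun p d => hq (p.1.2, p.2) (d.1.2, d.2), fun p => ho (p.1.2, p.2)⟩
  refine h.congr fun p => ?_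
  simp

end Recog

end Closure

/-! ### Counting -/

theorem encard_iUnion_fintype {ι α : Type*} [Fintype ι] {s : ι → Set α}
    (hs : Pairwise (Function.onFun Disjoint s)) : (⋃ i, s i).encard = ∑ i, (s i).encard := by
  rw [Set.encard_iUnion_of_finite hs, finsum_eq_sum_of_fintype]

theorem wordValue_nil {k : ℕ} : wordValue ([] : List (Fin k)) = 0 := rfl

theorem wordValue_append_singleton {k : ℕ} (w : List (Fin k)) (d : Fin k) :
    wordValue (w ++ [d]) = k * wordValue w + d := by
  simp [wordValue]

/-- The row vector is `c 0` because reading a word starts from the value `0`. -/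
theorem IsRegularSeq.of_vecMul {R : Type*} [Semiring R] {k r : ℕ} (c : ℕ → Fin r → R)
    (μ : Fin k → Matrix (Fin r) (Fin r) R) (v : Fin r → R)
    (hc : ∀ n (d : Fin k), c (k * n + d) = Matrix.vecMul (c n) (μ d)) :
    IsRegularSeq R k (fun n => c n ⬝ᵥ v) := by
  refine ⟨r, c 0, μ, v, fun w => ?_⟩
  rw [Matrix.dotProduct_mulVec]
  suffices h : c (wordValue w) = Matrix.vecMul (c 0) (w.map μ).prod from congrArg (· ⬝ᵥ v) h
  induction w using List.reverseRecOn with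
  | nil => simp [wordValue_nil]
  | append_singleton w d ih =>
    simp [wordValue_append_singleton, hc, ih, Matrix.vecMul_vecMul]

open Classical in
theorem Recog.isRegularSeq_encard {k : ℕ} [hk : Fact (2 ≤ k)] {P : ℕ → ℕ → Prop}
    (hP : Recog k (fun p : ℕ × ℕ => P p.1 p.2)) :
    IsRegularSeq ℕ∞ k (fun n => {m | P n m}.encard) := by
  obtain ⟨σ, hσ, q, step, out, hq, ho⟩ := hP
  obtain ⟨r, ⟨ε⟩⟩ := Finite.exists_equiv_fin σ
  let c : ℕ → Fin r → ℕ∞ := fun n s => {m | ε (q (n, m)) = s}.encard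
  let μ : Fin k → Matrix (Fin r) (Fin r) ℕ∞ := fun d s t =>
    ∑ e : Fin k, if ε (step (ε.symm s) (d, e)) = t then 1 else 0
  let v : Fin r → ℕ∞ := fun s => if out (ε.symm s) then 1 else 0
  convert IsRegularSeq.of_vecMul c μ v ?_ using 1
  · funext n
    have hU : {m | P n m} = ⋃ s : Fin r, {m | ε (q (n, m)) = s ∧ out (ε.symm s)} := by
      ext m
      have := ho (n, m)
      simp_all
    rw [hU, encard_iUnion_fintype]
    · refine Finset.sum_congr rfl fun s _ => ?_
      by_cases h : out (ε.symm s) <;> simp [h, c, v]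
    · intro s t hst
      refine Set.disjoint_left.2 fun m h1 h2 => hst ?_
      exact h1.1.symm.trans h2.1
  · intro n d
    funext t
    -- Each `m` is uniquely `k * m' + e` with `e < k`, so the fibre over `t` splits disjointly
    -- according to the state of `(n, m')` and the digit `e`.
    have hU : {m | ε (q (k * n + d, m)) = t} = ⋃ p : Fin r × Fin k, (fun m => k * m + (p.2 : ℕ)) ''
        {m | ε (q (n, m)) = p.1 ∧ ε (step (ε.symm p.1) (d, p.2)) = t} := by
      ext m
      simp only [Set.mem_ofPred_eq, Set.mem_iUnion, Set.mem_image, Prod.exists]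
      constructor
      · rintro rfl
        obtain ⟨m', e, rfl⟩ := Recog.exists_append (k := k) m
        refine ⟨ε (q (n, m')), e, m', ⟨rfl, ?_⟩, rfl⟩
        rw [Equiv.symm_apply_apply]
        exact congrArg ε (hq (n, m') (d, e)).symm
      · rintro ⟨_, e, m', ⟨rfl, rfl⟩, rfl⟩
        rw [Equiv.symm_apply_apply]
        exact congrArg ε (hq (n, m') (d, e))
    have hk0 : 0 < k := by have := hk.out; omega
    simp only [c, Matrix.vecMul, dotProduct, μ, Finset.mul_sum]
    rw [hU, encard_iUnion_fintype, Fintype.sum_prod_type]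
    · refine Finset.sum_congr rfl fun s _ => Finset.sum_congr rfl fun e _ => ?_
      rw [Function.Injective.encard_image]
      · by_cases h : ε (step (ε.symm s) (d, e)) = t <;> simp [h]
      · intro a b hab
        simpa [hk0.ne'] using hab
    · rintro ⟨s, e⟩ ⟨s', e'⟩ hne
      refine Set.disjoint_left.2 ?_
      rintro _ ⟨m, hm, rfl⟩ ⟨m', hm', h⟩
      dsimp only at h hm hm'
      have hm2 : m' = m := by
        have := congrArg (· / k) h
        simpa [Nat.mul_add_div hk0, Nat.div_eq_of_lt e.isLt, Nat.div_eq_of_lt e'.isLt] using this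
      subst hm2
      have he : e' = e := Fin.ext (by omega)
      exact hne (Prod.ext (hm.1.symm.trans hm'.1) he.symm)

/-! ### Automatic sequences -/

/-- The base-`k` representation of `n` without leading zero. -/
def canonicalWord (k : ℕ) [hk : Fact (2 ≤ k)] (n : ℕ) : List (Fin k) :=
  if h : n = 0 then []
  else canonicalWord k (n / k) ++ [⟨n % k, Nat.mod_lt _ (by have := hk.out; omega)⟩]
termination_by n
decreasing_by exact Nat.div_lt_self (Nat.pos_of_ne_zero h) hk.out

section CanonicalWord

variable {k : ℕ} [hk : Fact (2 ≤ k)]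

theorem canonicalWord_zero : canonicalWord k 0 = [] := by
  rw [canonicalWord, dif_pos rfl]

/-- In the excluded case the appended digit is a leading zero, and the canonical word stays empty.
-/
theorem canonicalWord_append {n : ℕ} {d : Fin k} (h : ¬ (n = 0 ∧ (d : ℕ) = 0)) :
    canonicalWord k (k * n + d) = canonicalWord k n ++ [d] := by
  have hk2 := hk.out
  have hk0 : 0 < k := by omega
  have hne : k * n + (d : ℕ) ≠ 0 := by
    simp only [ne_eq, Nat.add_eq_zero_iff, mul_eq_zero]
    omega
  rw [canonicalWord, dif_neg hne]
  congr 2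
  · rw [Nat.mul_add_div hk0, Nat.div_eq_of_lt d.isLt, add_zero]
  · ext
    simp [Nat.mod_eq_of_lt d.isLt]

theorem canonicalWord_spec (n : ℕ) :
    IsCanonical (canonicalWord k n) ∧ wordValue (canonicalWord k n) = n := by
  induction n using Nat.strong_induction_on with
  | _ n ih =>
    rcases Nat.eq_zero_or_pos n with rfl | hn
    · simp [canonicalWord_zero, IsCanonical, wordValue_nil]
    · obtain ⟨hw, hv⟩ := ih (n / k) (Nat.div_lt_self hn hk.out)
      rw [canonicalWord, dif_neg hn.ne']
      refine ⟨?_, by rw [wordValue_append_singleton, hv, Nat.div_add_mod]⟩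
      generalize canonicalWord k (n / k) = w at hw hv
      rcases w with _ | ⟨a, w⟩
      · have h1 : n / k = 0 := by rw [← hv]; rfl
        have h2 := Nat.div_add_mod n k
        rw [h1] at h2
        simp only [IsCanonical, List.nil_append, List.head?_cons, Option.mem_def,
          Option.some.injEq]
        rintro _ rfl
        simp only
        omega
      · simpa [IsCanonical] using hw

end CanonicalWord

-- The given automaton is only controlled on canonical words. A flag recording that the value is
-- still `0` lets the new automaton skip leading zeros.
open Classical in
theorem IsAutomatic.recog {α : Type*} {k : ℕ} [hk : Fact (2 ≤ k)] {x : ℕ → α}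
    (hx : IsAutomatic k x) : Recog k x := by
  obtain ⟨σ, hσ, M, hM⟩ := hx
  let q : ℕ → σ × Prop := fun n => ((canonicalWord k n).foldl M.step M.start, n = 0)
  refine ⟨σ × Prop, inferInstance, q, fun s (d : Fin k) =>
    if s.2 ∧ (d : ℕ) = 0 then s else (M.step s.1 d, False), fun s => M.output s.1, ?_, ?_⟩
  · intro n (d : Fin k)
    by_cases h : n = 0 ∧ (d : ℕ) = 0
    · refine Eq.trans ?_ (if_pos h).symm
      change q (k * n + d) = q n
      rw [h.1, h.2, mul_zero, zero_add]
    · refine Eq.trans ?_ (if_neg h).symm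
      change q (k * n + d) = _
      have hne : (k * n + (d : ℕ) = 0) = False := by
        have := hk.out
        simp only [Nat.add_eq_zero_iff, mul_eq_zero, eq_iff_iff, iff_false]
        omega
      simp only [q, canonicalWord_append h, hne, List.foldl_append, List.foldl_cons,
        List.foldl_nil]
  · intro n
    conv_lhs => rw [← (canonicalWord_spec (k := k) n).2]
    exact hM _ (canonicalWord_spec n).1

/-! ### Factors of a sequence -/

section Factor

variable {α : Type*} {x y : ℕ → α}

@[simp]
theorem length_factor (x : ℕ → α) (i l : ℕ) : (factor x i l).length = l := by
  simp [factor]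

@[simp]
theorem getElem_factor (x : ℕ → α) (i l t : ℕ) (h : t < (factor x i l).length) :
    (factor x i l)[t] = x (i + t) := by
  simp [factor]

theorem factor_eq_iff {i j l : ℕ} :
    factor x i l = factor y j l ↔ ∀ t, t < l → x (i + t) = y (j + t) := by
  simp [factor]

theorem factor_add (x : ℕ → α) (i a b : ℕ) :
    factor x i (a + b) = factor x i a ++ factor x (i + a) b := by
  simp [factor, List.range_add, add_assoc]

theorem isFactor_iff {w : List α} : IsFactor x w ↔ ∃ i, factor x i w.length = w := Iff.rfl

theorem isFactor_factor_iff {i l : ℕ} :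
    IsFactor y (factor x i l) ↔ ∃ j, factor y j l = factor x i l := by
  rw [isFactor_iff, length_factor]

/-- Infinitely many occurrences means unbounded occurrences, which is a first-order condition. -/
theorem isRecurrentFactor_factor_iff {i l : ℕ} :
    IsRecurrentFactor x (factor x i l) ↔ ∀ N, ∃ j, N ≤ j ∧ factor x j l = factor x i l := by
  rw [IsRecurrentFactor, Set.infinite_iff_exists_gt]
  simp only [OccursAt, length_factor, Set.mem_ofPred_eq]
  constructor
  · intro h N
    obtain ⟨j, hj, hN⟩ := h N
    exact ⟨j, hN.le, hj⟩
  · intro h N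
    obtain ⟨j, hN, hj⟩ := h (N + 1)
    exact ⟨j, hj, hN⟩

theorem IsRecurrentFactor.isFactor {w : List α} (h : IsRecurrentFactor x w) : IsFactor x w :=
  h.nonempty

theorem isSquareWord_factor_iff {i l : ℕ} :
    IsSquareWord (factor x i l) ↔ ∃ p, 1 ≤ p ∧ l = 2 * p ∧ factor x i p = factor x (i + p) p := by
  constructor
  · rintro ⟨u, hu, h⟩
    have hl : l = u.length + u.length := by simpa using congrArg List.length h
    refine ⟨u.length, List.length_pos_iff.2 hu, by omega, ?_⟩
    rw [hl, factor_add] at h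
    obtain ⟨h1, h2⟩ := List.append_inj h (by simp)
    rw [h1, h2]
  · rintro ⟨p, hp, rfl, h⟩
    refine ⟨factor x i p, ?_, ?_⟩
    · rw [← List.length_pos_iff, length_factor]
      exact hp
    · rw [two_mul, factor_add, ← h]

theorem isPalindromeWord_factor_iff {i l : ℕ} :
    IsPalindromeWord (factor x i l) ↔
      1 ≤ l ∧ ∀ a b, a + b + 1 = l → x (i + a) = x (i + b) := by
  rw [IsPalindromeWord, ← List.length_pos_iff, length_factor]
  refine and_congr Iff.rfl ⟨fun h a b hab => ?_, fun h => ?_⟩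
  · have ha : a < (factor x i l).reverse.length := by simp; omega
    have h1 : (factor x i l).reverse[a] = (factor x i l)[a]'(by simpa using ha) := by
      simp only [h]
    rw [List.getElem_reverse, getElem_factor, getElem_factor, length_factor] at h1
    rw [← h1]
    congr 2
    omega
  · refine List.ext_getElem (by simp) fun a h1 h2 => ?_
    rw [List.getElem_reverse, getElem_factor, getElem_factor, length_factor]
    rw [length_factor] at h2
    exact h _ _ (by omega)

/-- The hypothesis `h` says that `w` has period `p`. Removing the first block of length `p`
preserves the period and, while a full block remains, the block itself; the remainder shorter than
`p` becomes `u'`. -/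
theorem exists_flatten_replicate_append (p : ℕ) (hp : 1 ≤ p) (w : List α) (hw : p ≤ w.length)
    (h : w.drop p <+: w) :
    ∃ (m : ℕ) (u' : List α), 1 ≤ m ∧ u' <+: w.take p ∧
      w = (List.replicate m (w.take p)).flatten ++ u' := by
  induction hn : w.length using Nat.strong_induction_on generalizing w with
  | _ n ih =>
    rcases Nat.lt_or_ge (w.drop p).length p with hlt | hge
    · refine ⟨1, w.drop p, le_rfl, ?_, by simp⟩
      exact List.prefix_take_iff.2 ⟨h, hlt.le⟩
    · have htake : (w.drop p).take p = w.take p := by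
        obtain ⟨s, hs⟩ := h
        conv_rhs => rw [← hs, List.take_append_of_le_length hge]
      obtain ⟨m, u', hm, hu', he⟩ := ih (w.drop p).length (by rw [List.length_drop]; omega)
        (w.drop p) hge (h.drop p) rfl
      rw [htake] at hu' he
      refine ⟨m + 1, u', by omega, hu', ?_⟩
      rw [List.replicate_succ, List.flatten_cons, List.append_assoc, ← he, List.take_append_drop]

/-- The exponents of `w` are the quotients `|w| / p` over its periods `p ≤ |w|`, which replaces the
repeated block by a comparison of `w` with its shift. -/
theorem exists_hasExponent_iff {w : List α} {Q : ℚ → Prop} :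
    (∃ e, Q e ∧ HasExponent w e) ↔
      ∃ p : ℕ, 1 ≤ p ∧ p ≤ w.length ∧ w.drop p <+: w ∧ Q ((w.length : ℚ) / p) := by
  constructor
  · rintro ⟨_, hQ, u, u', m, hu, hm, hu', hw, rfl⟩
    obtain ⟨m, rfl⟩ : ∃ m', m = m' + 1 := ⟨m - 1, by omega⟩
    have h1 : w = u ++ ((List.replicate m u).flatten ++ u') := by
      rw [hw, List.replicate_succ, List.flatten_cons, List.append_assoc]
    refine ⟨u.length, List.length_pos_iff.2 hu, ?_, ?_, hQ⟩
    · rw [h1, List.length_append]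
      omega
    · have h2 : w.drop u.length = (List.replicate m u).flatten ++ u' := by rw [h1]; simp
      -- With the extra copy of `u` moved to the end of the power, the claim reduces to `u'` being a
      -- prefix of `u ++ u'`.
      rw [h2, hw, List.replicate_succ', List.flatten_append, List.append_assoc]
      refine (List.prefix_append_right_inj _).2 ?_
      simpa using hu'.trans (List.prefix_append _ _)
  · rintro ⟨p, hp, hpl, hd, hQ⟩
    obtain ⟨m, u', hm, hu', hw⟩ := exists_flatten_replicate_append p hp w hpl hd
    have hlen : (w.take p).length = p := by simpa using hpl
    refine ⟨_, hQ, w.take p, u', m, ?_, hm, hu', hw, by rw [hlen]⟩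
    rw [← List.length_pos_iff, hlen]
    exact hp

theorem exists_hasExponent_factor_iff {i l : ℕ} {Q : ℚ → Prop} :
    (∃ e, Q e ∧ HasExponent (factor x i l) e) ↔
      ∃ p : ℕ, 1 ≤ p ∧ Q ((l : ℚ) / p) ∧ ∃ s, p + s = l ∧ factor x (i + p) s = factor x i s := by
  rw [exists_hasExponent_iff]
  refine exists_congr fun p => and_congr Iff.rfl ?_
  rw [length_factor]
  constructor
  · rintro ⟨hpl, h, hQ⟩
    obtain ⟨s, rfl⟩ := Nat.exists_eq_add_of_le hpl
    refine ⟨hQ, s, rfl, ?_⟩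
    -- Splitting the word as `p + s` on one side and `s + p` on the other turns the prefix condition
    -- into equality of two factors of length `s`.
    have h2 := List.prefix_iff_eq_take.1 h
    rw [factor_add, List.drop_left' (by simp), length_factor, ← factor_add, add_comm p s,
      factor_add, List.take_left' (by simp)] at h2
    exact h2
  · rintro ⟨hQ, s, rfl, h⟩
    refine ⟨by omega, ?_, hQ⟩
    rw [factor_add, List.drop_left' (by simp), ← factor_add, h, add_comm p s, factor_add]
    exact List.prefix_append _ _

end Factor

/-! ### Words at a position, and distinct factors -/

section Positions

variable {α : Type*} {x : ℕ → α}

/-- The lengths of the words with property `P` that occur in `x` at position `n`. -/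
def lengthsAt (x : ℕ → α) (P : List α → Prop) (A : Anchor) (n : ℕ) : Set ℕ :=
  {l | ∃ i, A.Locates i l n ∧ P (factor x i l)}

theorem Anchor.Locates.injective {A : Anchor} {i j l n : ℕ} (hi : A.Locates i l n)
    (hj : A.Locates j l n) : i = j := by
  cases A <;> simp only [Anchor.Locates] at hi hj <;> omega

theorem image_length_wordsAt (P : List α → Prop) (A : Anchor) (n : ℕ) :
    List.length '' wordsAt x P A n = lengthsAt x P A n := by
  ext l
  constructor
  · rintro ⟨w, ⟨hP, i, hw, hA⟩, rfl⟩
    refine ⟨i, hA, ?_⟩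
    rwa [hw]
  · rintro ⟨i, hA, hP⟩
    exact ⟨factor x i l, ⟨hP, i, by simp [OccursAt], by simpa using hA⟩, by simp⟩

theorem encard_wordsAt (P : List α → Prop) (A : Anchor) (n : ℕ) :
    (wordsAt x P A n).encard = (lengthsAt x P A n).encard := by
  rw [← image_length_wordsAt, Set.InjOn.encard_image]
  rintro w ⟨-, i, hw, hA⟩ w' ⟨-, j, hw', hA'⟩ h
  rw [OccursAt] at hw hw'
  rw [← h] at hw' hA'
  rw [← hw, ← hw', hA.injective hA']

/-- The numbers below some element of `L` form an initial segment of `ℕ` whose size is the supremum,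
so lengths of longest words become counts. -/
theorem iSup_natCast_eq_encard (L : Set ℕ) :
    ⨆ l ∈ L, (l : ℕ∞) = {m | ∃ l, l ∈ L ∧ m < l}.encard := by
  have hIio : ∀ N : ℕ, (Set.Iio N).encard = N := fun N => by
    rw [← Finset.coe_Iio, Set.encard_coe_eq_coe_finsetCard, Nat.card_Iio]
  apply le_antisymm
  · refine iSup₂_le fun l hl => ?_
    rw [← hIio l]
    exact Set.encard_le_encard fun m hm => ⟨l, hl, hm⟩
  · generalize hN : (⨆ l ∈ L, (l : ℕ∞)) = N
    induction N using ENat.recTopCoe with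
    | top => exact le_top
    | coe N =>
      rw [← hIio N]
      refine Set.encard_le_encard ?_
      rintro m ⟨l, hl, hm⟩
      have : (l : ℕ∞) ≤ N := hN ▸ le_iSup₂ (f := fun (l : ℕ) (_ : l ∈ L) => (l : ℕ∞)) l hl
      exact lt_of_lt_of_le hm (by exact_mod_cast this)

theorem longest_wordsAt (P : List α → Prop) (A : Anchor) (n : ℕ) :
    longest (wordsAt x P A n) = {m | ∃ l, l ∈ lengthsAt x P A n ∧ m < l}.encard := by
  rw [← iSup_natCast_eq_encard, ← image_length_wordsAt, iSup_image, longest]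

/-- Distinct factors are counted by their first occurrences. -/
theorem encard_factors (Q : List α → Prop) (n : ℕ) :
    {w | IsFactor x w ∧ w.length = n ∧ Q w}.encard =
      {i | Q (factor x i n) ∧ ∀ j, j < i → factor x j n ≠ factor x i n}.encard := by
  classical
  rw [← Set.InjOn.encard_image (f := fun i => factor x i n)]
  · congr 1
    ext w
    constructor
    · rintro ⟨h, rfl, hQ⟩
      have h' : ∃ i, factor x i w.length = w := h
      refine ⟨Nat.find h', ⟨?_, fun j hj => ?_⟩, Nat.find_spec h'⟩
      · rwa [Nat.find_spec h']
      · rw [Nat.find_spec h']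
        exact Nat.find_min h' hj
    · rintro ⟨i, ⟨hQ, -⟩, rfl⟩
      exact ⟨isFactor_factor_iff.2 ⟨i, rfl⟩, by simp, hQ⟩
  · rintro i ⟨-, hi⟩ j ⟨-, hj⟩ h
    rcases lt_trichotomy i j with hij | hij | hij
    · exact absurd h (hj i hij)
    · exact hij
    · exact absurd h.symm (hi j hij)

end Positions

/-! ### Recognizability of properties of factors -/

section Definable

variable {α : Type*} {x y : ℕ → α} {k : ℕ} [hk : Fact (2 ≤ k)] {D : Type} [DigitSpace k D]

theorem Recog.factor_eq (hx : Recog k x) (hy : Recog k y) {i j l : D → ℕ} (hi : IsAffine k i)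
    (hj : IsAffine k j) (hl : IsAffine k l) :
    Recog k (fun p => factor x (i p) (l p) = factor y (j p) (l p)) := by
  have hxy : Recog k (fun p : ℕ × ℕ => x p.1 = y p.2) := hx.fst.map₂ hy.snd _
  exact (forall' ((lt .var hl.fst).imp
    (comp₂ (R := fun a b => x a = y b) hxy (hi.fst.add .var) (hj.fst.add .var)))).congr fun p => factor_eq_iff

theorem Recog.isSquareWord (hx : Recog k x) :
    Recog k (fun p : ℕ × ℕ => IsSquareWord (factor x p.1 p.2)) :=
  (exists' ((le (.const 1) .var).and ((eq IsAffine.var.fst (.const_mul 2 .var)).and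
    (factor_eq hx hx IsAffine.var_fst.fst (IsAffine.var_fst.fst.add .var) .var)))).congr
    fun _ => isSquareWord_factor_iff

theorem Recog.isPalindromeWord (hx : Recog k x) :
    Recog k (fun p : ℕ × ℕ => IsPalindromeWord (factor x p.1 p.2)) := by
  have hxx : Recog k (fun p : ℕ × ℕ => x p.1 = x p.2) := hx.fst.map₂ hx.snd _
  exact ((le (.const 1) .var).and (forall' (forall' ((eq
    ((IsAffine.var.fst.add .var).add (.const 1)) IsAffine.var.fst.fst).imp
    (comp₂ (R := fun a b => x a = x b) hxx (IsAffine.var_fst.fst.fst.add IsAffine.var.fst)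
      (IsAffine.var_fst.fst.fst.add .var)))))).congr fun _ => isPalindromeWord_factor_iff

theorem Recog.exists_hasExponent (hx : Recog k x) {Q : ℚ → Prop}
    (hQ : Recog k (fun p : ℕ × ℕ => 1 ≤ p.2 ∧ Q ((p.1 : ℚ) / p.2))) :
    Recog k (fun p : ℕ × ℕ => ∃ e, Q e ∧ HasExponent (factor x p.1 p.2) e) :=
  (exists' ((comp₂ (R := fun l p => 1 ≤ p ∧ Q ((l : ℚ) / p)) hQ IsAffine.var.fst .var).and
    (exists' ((eq (IsAffine.var.fst.add .var) IsAffine.var.fst.fst).and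
      (factor_eq hx hx (IsAffine.var_fst.fst.fst.add IsAffine.var.fst)
        IsAffine.var_fst.fst.fst .var))))).congr
    fun _ => exists_hasExponent_factor_iff.trans (exists_congr fun _ => and_assoc.symm)

/-- For fixed `r` the comparison is linear in `l` and `p` after cross-multiplication. The numerator
is split into positive and negative parts so that both sides are natural-number terms. -/
theorem rat_le_div_iff (r : ℚ) {l p : ℕ} (hp : 1 ≤ p) :
    r ≤ (l : ℚ) / p ↔ r.num.toNat * p ≤ r.den * l + (-r.num).toNat * p := by
  have hp' : (0 : ℚ) < p := by exact_mod_cast hp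
  have hd : (0 : ℚ) < r.den := by exact_mod_cast r.den_pos
  have h1 : r ≤ (l : ℚ) / p ↔ r.num * (p : ℤ) ≤ r.den * (l : ℤ) := by
    conv_lhs => rw [← Rat.num_div_den r, div_le_div_iff₀ hd hp', mul_comm (l : ℚ)]
    exact_mod_cast Iff.rfl
  rw [h1, ← Int.ofNat_le]
  push_cast
  have h2 : r.num = (r.num.toNat : ℤ) - ((-r.num).toNat : ℤ) := by omega
  conv_lhs => rw [h2, sub_mul]
  simp only [Int.ofNat_toNat]
  omega

theorem rat_lt_div_iff (r : ℚ) {l p : ℕ} (hp : 1 ≤ p) :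
    r < (l : ℚ) / p ↔ r.num.toNat * p < r.den * l + (-r.num).toNat * p := by
  have hp' : (0 : ℚ) < p := by exact_mod_cast hp
  have hd : (0 : ℚ) < r.den := by exact_mod_cast r.den_pos
  have h1 : r < (l : ℚ) / p ↔ r.num * (p : ℤ) < r.den * (l : ℤ) := by
    conv_lhs => rw [← Rat.num_div_den r, div_lt_div_iff₀ hd hp', mul_comm (l : ℚ)]
    exact_mod_cast Iff.rfl
  rw [h1, ← Int.ofNat_lt]
  push_cast
  have h2 : r.num = (r.num.toNat : ℤ) - ((-r.num).toNat : ℤ) := by omega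
  conv_lhs => rw [h2, sub_mul]
  simp only [Int.ofNat_toNat]
  omega

theorem Recog.exists_le_hasExponent (hx : Recog k x) (r : ℚ) :
    Recog k (fun p : ℕ × ℕ => ∃ e, r ≤ e ∧ HasExponent (factor x p.1 p.2) e) :=
  hx.exists_hasExponent <| ((le (.const 1) .var).and (le (.const_mul r.num.toNat .var)
    ((IsAffine.var_fst.const_mul r.den).add (.const_mul (-r.num).toNat .var)))).congr
    fun _ => and_congr_right (rat_le_div_iff r)

theorem Recog.exists_lt_hasExponent (hx : Recog k x) (r : ℚ) :
    Recog k (fun p : ℕ × ℕ => ∃ e, r < e ∧ HasExponent (factor x p.1 p.2) e) :=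
  hx.exists_hasExponent <| ((le (.const 1) .var).and (lt (.const_mul r.num.toNat .var)
    ((IsAffine.var_fst.const_mul r.den).add (.const_mul (-r.num).toNat .var)))).congr
    fun _ => and_congr_right (rat_lt_div_iff r)

theorem Recog.isFractionalPower (hx : Recog k x) :
    Recog k (fun p : ℕ × ℕ => IsFractionalPower (factor x p.1 p.2)) :=
  (hx.exists_hasExponent (Q := fun _ => True)
    ((le (.const 1) .var).congr fun _ => by simp)).congr fun _ => by
      simp [IsFractionalPower]

theorem Recog.isFactor (hx : Recog k x) (hy : Recog k y) :
    Recog k (fun p : ℕ × ℕ => IsFactor y (factor x p.1 p.2)) :=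
  (exists' (factor_eq hy hx .var IsAffine.var_fst.fst IsAffine.var.fst)).congr
    fun _ => isFactor_factor_iff

theorem Recog.isRecurrentFactor (hx : Recog k x) :
    Recog k (fun p : ℕ × ℕ => IsRecurrentFactor x (factor x p.1 p.2)) :=
  (forall' (exists' ((le IsAffine.var.fst .var).and
    (factor_eq hx hx .var IsAffine.var_fst.fst.fst IsAffine.var.fst.fst)))).congr
    fun _ => isRecurrentFactor_factor_iff

theorem Recog.locates (A : Anchor) {i l n : D → ℕ} (hi : IsAffine k i) (hl : IsAffine k l)
    (hn : IsAffine k n) : Recog k (fun p => A.Locates (i p) (l p) (n p)) := by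
  have hn2 : IsAffine k (fun p => 2 * n p) := hn.const_mul 2
  have hi2 : IsAffine k (fun p => 2 * i p) := hi.const_mul 2
  cases A with
  | start => exact eq hn hi
  | finish => exact eq (hn.add (.const 1)) (hi.add hl)
  | centreExact => exact eq (hn2.add (.const 1)) (hi2.add hl)
  | centreRight =>
    exact ((le hn2 (hi2.add hl)).and (le (hi2.add hl) (hn2.add (.const 1)))).congr fun p => by
      simp only [Anchor.Locates]
      omega
  | centreLeft =>
    -- Truncated subtraction gives `(0 - 1) / 2 = 0`, so the inequalities describing the floor are
    -- valid only for `l ≥ 1`.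
    have hl0 := eq hl (.const 0)
    exact ((hl0.imp (eq hn hi)).and (hl0.not.imp ((le (hn2.add (.const 1)) (hi2.add hl)).and
      (le (hi2.add hl) (hn2.add (.const 2)))))).congr fun p => by
        simp only [Anchor.Locates]
        omega

theorem Recog.lengthsAt {P : List α → Prop}
    (hP : Recog k (fun p : ℕ × ℕ => P (factor x p.1 p.2))) (A : Anchor) :
    Recog k (fun p : ℕ × ℕ => p.2 ∈ lengthsAt x P A p.1) :=
  exists' ((locates A .var IsAffine.var.fst IsAffine.var_fst.fst).and
    (comp₂ (R := fun i l => P (factor x i l)) hP .var IsAffine.var.fst))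

theorem isRegularSeq_encard_wordsAt {P : List α → Prop}
    (hP : Recog k (fun p : ℕ × ℕ => P (factor x p.1 p.2))) (A : Anchor) :
    IsRegularSeq ℕ∞ k (fun n => (wordsAt x P A n).encard) := by
  simp only [encard_wordsAt]
  exact (Recog.lengthsAt hP A).isRegularSeq_encard (P := fun n l => l ∈ lengthsAt x P A n)

theorem isRegularSeq_longest_wordsAt {P : List α → Prop}
    (hP : Recog k (fun p : ℕ × ℕ => P (factor x p.1 p.2))) (A : Anchor) :
    IsRegularSeq ℕ∞ k (fun n => longest (wordsAt x P A n)) := by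
  simp only [longest_wordsAt]
  exact Recog.isRegularSeq_encard (.exists' (.and
    (.comp₂ (R := fun n l => l ∈ lengthsAt x P A n) (Recog.lengthsAt hP A)
      IsAffine.var_fst.fst .var) (.lt IsAffine.var.fst .var)))

theorem isRegularSeq_encard_factors (hx : Recog k x) {Q : List α → Prop}
    (hQ : Recog k (fun p : ℕ × ℕ => Q (factor x p.1 p.2))) :
    IsRegularSeq ℕ∞ k (fun n => {w | IsFactor x w ∧ w.length = n ∧ Q w}.encard) := by
  simp only [encard_factors]
  exact Recog.isRegularSeq_encard (.and
    (.comp₂ (R := fun i l => Q (factor x i l)) hQ .var IsAffine.var_fst)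
    (.forall' (.imp (.lt .var IsAffine.var.fst)
      (.not (.factor_eq hx hx .var IsAffine.var.fst IsAffine.var_fst.fst)))))

end Definable

end AutoSeq

open AutoSeq
theorem mainTheorem9 {α : Type*} (k : ℕ) (hk : 2 ≤ k) (x y : ℕ → α)
    (hx : IsAutomatic k x) (hy : IsAutomatic k y) :
    -- (a) distinct square factors of length `n`
    IsRegularSeq ℕ∞ k (fun n => {w | IsFactor x w ∧ w.length = n ∧ IsSquareWord w}.encard) ∧
    -- (b) number of squares beginning / centred / ending at `n`
    (∀ A : Anchor, IsRegularSeq ℕ∞ k (fun n => (wordsAt x IsSquareWord A n).encard)) ∧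
    -- (c) length of the longest square beginning / centred / ending at `n`
    (∀ A : Anchor, IsRegularSeq ℕ∞ k (fun n => longest (wordsAt x IsSquareWord A n))) ∧
    -- (d) number of palindromes beginning / centred / ending at `n`
    (∀ A : Anchor, IsRegularSeq ℕ∞ k (fun n => (wordsAt x IsPalindromeWord A n).encard)) ∧
    -- (e) length of the longest palindrome beginning / centred / ending at `n`
    (∀ A : Anchor, IsRegularSeq ℕ∞ k (fun n => longest (wordsAt x IsPalindromeWord A n))) ∧
    -- (f) length of the longest fractional power beginning / ending at `n`, without restriction
    -- on the exponent, and with exponent at least, or greater than, a given rational number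
    (∀ A : Anchor, A = .start ∨ A = .finish →
      IsRegularSeq ℕ∞ k (fun n => longest (wordsAt x IsFractionalPower A n)) ∧
      ∀ r : ℚ,
        IsRegularSeq ℕ∞ k (fun n => longest (wordsAt x (fun w => ∃ e, r ≤ e ∧ HasExponent w e) A n)) ∧
        IsRegularSeq ℕ∞ k
          (fun n => longest (wordsAt x (fun w => ∃ e, r < e ∧ HasExponent w e) A n))) ∧
    -- (g) distinct recurrent factors of length `n`
    IsRegularSeq ℕ∞ k (fun n => {w | IsRecurrentFactor x w ∧ w.length = n}.encard) ∧
    -- (h) factors of length `n` that occur in `x` but not in `y`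
    IsRegularSeq ℕ∞ k (fun n => {w | IsFactor x w ∧ ¬ IsFactor y w ∧ w.length = n}.encard) ∧
    -- (i) factors of length `n` that occur in both `x` and `y`
    IsRegularSeq ℕ∞ k (fun n => {w | IsFactor x w ∧ IsFactor y w ∧ w.length = n}.encard) := by
  have : Fact (2 ≤ k) := ⟨hk⟩
  have hx' := hx.recog
  have hy' := hy.recog
  refine ⟨isRegularSeq_encard_factors hx' hx'.isSquareWord,
    isRegularSeq_encard_wordsAt hx'.isSquareWord, isRegularSeq_longest_wordsAt hx'.isSquareWord,
    isRegularSeq_encard_wordsAt hx'.isPalindromeWord,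
    isRegularSeq_longest_wordsAt hx'.isPalindromeWord,
    fun A _ => ⟨isRegularSeq_longest_wordsAt hx'.isFractionalPower A, fun r =>
      ⟨isRegularSeq_longest_wordsAt (hx'.exists_le_hasExponent r) A,
        isRegularSeq_longest_wordsAt (hx'.exists_lt_hasExponent r) A⟩⟩, ?_, ?_, ?_⟩
  -- A recurrent factor is in particular a factor, so the count fits the general form.
  · convert isRegularSeq_encard_factors hx' hx'.isRecurrentFactor using 3 with n
    ext w
    exact ⟨fun h => ⟨h.1.isFactor, h.2, h.1⟩, fun h => ⟨h.2.2, h.2.1⟩⟩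
  · convert isRegularSeq_encard_factors (Q := fun w => ¬ IsFactor y w) hx'
      (hx'.isFactor hy').not using 3 with n
    ext w
    exact and_congr_right fun _ => and_comm
  · convert isRegularSeq_encard_factors hx' (hx'.isFactor hy') using 3 with n
    ext w
    exact and_congr_right fun _ => and_comm
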